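/- Let $S^1=[0,2]/(0\sim 2)$ and let $\mathrm{Imm}(S^1,\mathbb{R}^3)$ be the space of smooth immersed loops with the $C^\infty$ topology. Let $\mathrm{Sim}$ be the group of orientation-preserving Euclidean similarities $x\mapsto rAx+b$ with $r>0$, $A\in\mathrm{SO}(3)$, $b\in\mathbb{R}^3$, and let $\mathcal{B}=\mathrm{Imm}(S^1,\mathbb{R}^3)/\mathrm{Sim}$ with the quotient topology. A framed loop is a pair $(\gamma,V)$ with $\gamma\in\mathrm{Imm}(S^1,\mathbb{R}^3)$ and $V:S^1\to\mathbb{R}^3$ a smooth unit normal vector field along $\gamma$; framed loops carry the $C^\infty$ topology. A similarity $x\mapsto rAx+b$ sends $(\gamma,V)$ to $(rA\gamma+b,\,AV)$, and $e^{i\theta}\in\mathbb{S}^1$ acts by constant frame twisting, $e^{i\theta}\cdot(\gamma,V)=(\gamma,\cos(2\theta)V+\sin(2\theta)W)$ with $W=\frac{\gamma'}{\|\gamma'\|}\times V$. Let $\mathcal{M}=\{\text{framed loops}\}/(\mathrm{Sim}\times\mathbb{S}^1)$ with the quotient topology. A curve framing algorithm on a subset $U\subset\mathcal{B}$ is a continuous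 map $s:U\to\mathcal{M}$ that is a section of the forget-framing map $\mathcal{M}\to\mathcal{B}$, $[\gamma,V]\mapsto[\gamma]$. Then there is no curve framing algorithm defined on all of $\mathcal{B}$; that is, the forget-framing map $\mathcal{M}\to\mathcal{B}$ has no continuous global section. -/

import Mathlib

open scoped ContDiff

noncomputable section

namespace FramedCurves

/-- Euclidean three-space `ℝ³`. -/
abbrev E3 : Type := EuclideanSpace ℝ (Fin 3)

/-- The cross product of `ℝ³`. -/
def cross (u v : E3) : E3 := WithLp.toLp 2 (crossProduct u.ofLp v.ofLp)

/-- The rotation group `SO(3)`. -/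
abbrev SO3 : Type := Matrix.specialOrthogonalGroup (Fin 3) ℝ

/-- A rotation applied to a vector of `ℝ³`. -/
def rot (A : SO3) (v : E3) : E3 := WithLp.toLp 2 (A.1.mulVec v.ofLp)

/-! ### Smooth loops and their Fréchet topology -/

/-- A smooth loop `S¹ → ℝ³`, where `S¹ = [0,2]/(0 ∼ 2) = ℝ/2ℤ`: a smooth map `ℝ → ℝ³` of
period `2`. -/
@[ext]
structure SmoothLoop where
  toFun : ℝ → E3
  smooth : ContDiff ℝ ∞ toFun
  periodic : Function.Periodic toFun 2

instance : CoeFun SmoothLoop (fun _ => ℝ → E3) := ⟨SmoothLoop.toFun⟩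

/-- The `n`-th derivative of a smooth loop, as a continuous map. -/
def SmoothLoop.jet (γ : SmoothLoop) (n : ℕ) : C(ℝ, E3) where
  toFun := iteratedDeriv n γ
  continuous_toFun := γ.smooth.continuous_iteratedDeriv n (by exact_mod_cast le_top)

/-- The `C^∞` (Fréchet) topology on `C^∞(S¹, ℝ³)`: convergence of all derivatives, locally
uniformly on `ℝ` (which for maps of period `2` is the same as uniformly). -/
instance : TopologicalSpace SmoothLoop :=
  TopologicalSpace.induced SmoothLoop.jet inferInstance

/-- The space `Imm(S¹, ℝ³)` of smooth immersed loops, with the `C^∞` topology. -/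
def ImmersedLoop : Type := {γ : SmoothLoop // ∀ t, deriv γ t ≠ 0}

instance : TopologicalSpace ImmersedLoop :=
  inferInstanceAs (TopologicalSpace {γ : SmoothLoop // ∀ t, deriv γ t ≠ 0})

/-- The space of framed loops `(γ, V)`: `γ` is an immersed smooth loop and `V` is a smooth
(closed) unit normal vector field along it. It carries the `C^∞` topology. -/
def FramedLoop : Type :=
  {p : SmoothLoop × SmoothLoop //
    (∀ t, deriv p.1 t ≠ 0) ∧ (∀ t, ‖p.2 t‖ = 1) ∧ ∀ t, inner ℝ (p.2 t) (deriv p.1 t) = 0}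

instance : TopologicalSpace FramedLoop :=
  inferInstanceAs (TopologicalSpace {p : SmoothLoop × SmoothLoop //
    (∀ t, deriv p.1 t ≠ 0) ∧ (∀ t, ‖p.2 t‖ = 1) ∧ ∀ t, inner ℝ (p.2 t) (deriv p.1 t) = 0})

/-- The base curve of a framed loop. -/
def FramedLoop.base (p : FramedLoop) : ImmersedLoop := ⟨p.1.1, p.2.1⟩

/-- The framing of a framed loop. -/
def FramedLoop.framing (p : FramedLoop) : SmoothLoop := p.1.2

/-- The unit tangent vector `T = γ' / ‖γ'‖`. -/
def ImmersedLoop.tangent (γ : ImmersedLoop) (t : ℝ) : E3 :=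
  ‖deriv γ.1 t‖⁻¹ • deriv γ.1 t

/-- The framing `V` twisted by the constant angle `2θ`:
`cos (2θ) V + sin (2θ) W`, where `W = T × V`. -/
def FramedLoop.twist (p : FramedLoop) (θ : ℝ) (t : ℝ) : E3 :=
  Real.cos (2 * θ) • p.framing t +
    Real.sin (2 * θ) • cross (p.base.tangent t) (p.framing t)

/-! ### The equivalence relations -/

/-- Two immersed loops are similar if they differ by an (orientation preserving) Euclidean
similarity `x ↦ r A x + b`, with `r > 0`, `A ∈ SO(3)`, `b ∈ ℝ³`. -/
def ImmersedLoop.Similar (γ₁ γ₂ : ImmersedLoop) : Prop :=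
  ∃ (r : ℝ) (A : SO3) (b : E3), 0 < r ∧ ∀ t, γ₂.1 t = r • rot A (γ₁.1 t) + b

/-- Two framed loops define the same relatively framed loop up to similarity if they differ by
a Euclidean similarity (which acts on framings through its rotation part) and a constant
frame twist. -/
def FramedLoop.Similar (p₁ p₂ : FramedLoop) : Prop :=
  ∃ (r : ℝ) (A : SO3) (b : E3) (θ : ℝ), 0 < r ∧
    (∀ t, p₂.base.1 t = r • rot A (p₁.base.1 t) + b) ∧
    ∀ t, p₂.framing t = rot A (p₁.twist θ t)

/-! Elementary facts, needed only to see that these are equivalence relations. -/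

theorem rot_add (A : SO3) (u v : E3) : rot A (u + v) = rot A u + rot A v := by
  ext i; simp [rot, Matrix.mulVec_add]

theorem rot_smul (A : SO3) (c : ℝ) (v : E3) : rot A (c • v) = c • rot A v := by
  ext i; simp [rot, Matrix.mulVec_smul]

theorem rot_one (v : E3) : rot 1 v = v := by
  ext i; simp [rot]

theorem rot_mul (A B : SO3) (v : E3) : rot (A * B) v = rot A (rot B v) := by
  ext i; simp [rot, Matrix.mulVec_mulVec]

theorem rot_inv_rot (A : SO3) (v : E3) : rot A⁻¹ (rot A v) = v := by
  rw [← rot_mul, inv_mul_cancel, rot_one]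

theorem inner_eq_dot (u v : E3) : inner ℝ u v = dotProduct u.ofLp v.ofLp := by
  rw [EuclideanSpace.inner_eq_star_dotProduct]; simp [dotProduct_comm]

theorem orth_mul (A : SO3) : A.1.transpose * A.1 = 1 := by
  have h := (Matrix.mem_specialOrthogonalGroup_iff.1 A.2).1
  simpa [Matrix.star_eq_conjTranspose] using (Matrix.mem_orthogonalGroup_iff' (Fin 3) ℝ).1 h

theorem inner_rot (A : SO3) (u v : E3) : inner ℝ (rot A u) (rot A v) = inner ℝ u v := by
  simp only [inner_eq_dot, rot]
  rw [Matrix.dotProduct_mulVec, Matrix.vecMul_mulVec, orth_mul, Matrix.vecMul_one]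

theorem norm_rot (A : SO3) (v : E3) : ‖rot A v‖ = ‖v‖ := by
  rw [← sq_eq_sq₀ (norm_nonneg _) (norm_nonneg _), ← real_inner_self_eq_norm_sq,
    ← real_inner_self_eq_norm_sq, inner_rot]

theorem cross_add (u v w : E3) : cross u (v + w) = cross u v + cross u w := by
  ext i; simp [cross]

theorem cross_smul (u : E3) (c : ℝ) (v : E3) : cross u (c • v) = c • cross u v := by
  ext i; simp [cross]

theorem dot_cross_rot (A : SO3) (u v w : E3) :
    inner ℝ (rot A w) (cross (rot A u) (rot A v)) = inner ℝ w (cross u v) := by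
  have hdet : A.1.det = 1 := (Matrix.mem_specialOrthogonalGroup_iff.1 A.2).2
  simp only [inner_eq_dot, rot, cross]
  rw [triple_product_eq_det, triple_product_eq_det]
  have : Matrix.of ![A.1.mulVec w.ofLp, A.1.mulVec u.ofLp, A.1.mulVec v.ofLp]
      = Matrix.of ![w.ofLp, u.ofLp, v.ofLp] * A.1.transpose := by
    ext i j
    fin_cases i <;> simp [Matrix.mul_apply, Matrix.mulVec, dotProduct, mul_comm]
  have h2 := congrArg Matrix.det this
  rwa [Matrix.det_mul, Matrix.det_transpose, hdet, mul_one] at h2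

theorem rot_cross (A : SO3) (u v : E3) : rot A (cross u v) = cross (rot A u) (rot A v) := by
  refine ext_inner_left ℝ fun w => ?_
  have hw : w = rot A (rot A⁻¹ w) := by rw [← rot_mul, mul_inv_cancel, rot_one]
  rw [hw, inner_rot, dot_cross_rot]

theorem cross_cross_of_orth {u v : E3} (hu : ‖u‖ = 1) (huv : inner ℝ v u = 0) :
    cross u (cross u v) = -v := by
  have h1 : inner ℝ u u = 1 := by rw [real_inner_self_eq_norm_sq, hu, one_pow]
  rw [inner_eq_dot] at h1 huv
  simp only [dotProduct, Fin.sum_univ_three] at h1 huv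
  ext i
  fin_cases i
  · simp [cross, crossProduct]
    linear_combination (-v.ofLp 0) * h1 + u.ofLp 0 * huv
  · simp [cross, crossProduct]
    linear_combination (-v.ofLp 1) * h1 + u.ofLp 1 * huv
  · simp [cross, crossProduct]
    linear_combination (-v.ofLp 2) * h1 + u.ofLp 2 * huv

theorem SmoothLoop.differentiable (γ : SmoothLoop) : Differentiable ℝ γ :=
  γ.smooth.differentiable (by simp)

theorem ImmersedLoop.deriv_eq {γ₁ γ₂ : ImmersedLoop} {r : ℝ} {A : SO3} {b : E3}
    (h : ∀ t, γ₂.1 t = r • rot A (γ₁.1 t) + b) (t : ℝ) :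
    deriv γ₂.1 t = r • rot A (deriv γ₁.1 t) := by
  let L : E3 →L[ℝ] E3 :=
    LinearMap.toContinuousLinearMap ⟨⟨rot A, rot_add A⟩, rot_smul A⟩
  have h1 : HasDerivAt γ₁.1.toFun (deriv γ₁.1 t) t := (γ₁.1.differentiable t).hasDerivAt
  have h2 : HasDerivAt (fun t => r • rot A (γ₁.1 t) + b) (r • rot A (deriv γ₁.1 t)) t :=
    ((L.hasFDerivAt.comp_hasDerivAt t h1).const_smul r).add_const b
  rw [show γ₂.1.toFun = fun t => r • rot A (γ₁.1 t) + b from funext h]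
  exact h2.deriv

theorem ImmersedLoop.tangent_eq {γ₁ γ₂ : ImmersedLoop} {r : ℝ} {A : SO3} {b : E3} (hr : 0 < r)
    (h : ∀ t, γ₂.1 t = r • rot A (γ₁.1 t) + b) (t : ℝ) :
    γ₂.tangent t = rot A (γ₁.tangent t) := by
  simp only [ImmersedLoop.tangent]
  rw [ImmersedLoop.deriv_eq h, norm_smul, norm_rot, rot_smul, smul_smul, Real.norm_of_nonneg hr.le]
  congr 1
  field_simp

theorem ImmersedLoop.norm_tangent (γ : ImmersedLoop) (t : ℝ) : ‖γ.tangent t‖ = 1 := by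
  rw [ImmersedLoop.tangent, norm_smul, norm_inv, norm_norm,
    inv_mul_cancel₀ (norm_ne_zero_iff.2 (γ.2 t))]

theorem FramedLoop.inner_tangent (p : FramedLoop) (t : ℝ) :
    inner ℝ (p.framing t) (p.base.tangent t) = 0 := by
  have h : inner ℝ (p.framing t) (deriv p.base.1 t) = 0 := p.2.2.2 t
  rw [ImmersedLoop.tangent, inner_smul_right, h, mul_zero]

/-- If `V₂` is a rotated twist of `V₁`, then any further twist of `V₂` is the rotated sum
twist. -/
theorem FramedLoop.twist_twist {p₁ p₂ : FramedLoop} {r : ℝ} {A : SO3} {b : E3} {θ : ℝ}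
    (hr : 0 < r) (hb : ∀ t, p₂.base.1 t = r • rot A (p₁.base.1 t) + b)
    (hV : ∀ t, p₂.framing t = rot A (p₁.twist θ t)) (φ t : ℝ) :
    p₂.twist φ t = rot A (p₁.twist (θ + φ) t) := by
  have hc := cross_cross_of_orth (p₁.base.norm_tangent t) (p₁.inner_tangent t)
  rw [FramedLoop.twist, hV, ImmersedLoop.tangent_eq hr hb, ← rot_cross, ← rot_smul, ← rot_smul,
    ← rot_add]
  congr 1
  simp only [FramedLoop.twist]
  rw [cross_add, cross_smul, cross_smul, hc, mul_add, Real.cos_add, Real.sin_add]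
  module

theorem FramedLoop.twist_zero (p : FramedLoop) (t : ℝ) : p.twist 0 t = p.framing t := by
  simp [FramedLoop.twist]

theorem ImmersedLoop.similar_equivalence : Equivalence ImmersedLoop.Similar where
  refl γ := ⟨1, 1, 0, one_pos, fun t => by simp [rot_one]⟩
  symm := by
    rintro γ₁ γ₂ ⟨r, A, b, hr, h⟩
    refine ⟨r⁻¹, A⁻¹, -(r⁻¹ • rot A⁻¹ b), inv_pos.2 hr, fun t => ?_⟩
    rw [h, rot_add, rot_smul, rot_inv_rot, smul_add, smul_smul, inv_mul_cancel₀ hr.ne', one_smul,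
      add_neg_cancel_right]
  trans := by
    rintro γ₁ γ₂ γ₃ ⟨r, A, b, hr, h⟩ ⟨s, B, c, hs, k⟩
    refine ⟨s * r, B * A, s • rot B b + c, mul_pos hs hr, fun t => ?_⟩
    rw [k, h, rot_add, rot_smul, rot_mul, smul_add, smul_smul, add_assoc]

theorem FramedLoop.similar_equivalence : Equivalence FramedLoop.Similar where
  refl p := ⟨1, 1, 0, 0, one_pos, fun t => by simp [rot_one], fun t => by
    rw [rot_one, FramedLoop.twist_zero]⟩
  symm := by
    rintro p₁ p₂ ⟨r, A, b, θ, hr, h, hV⟩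
    refine ⟨r⁻¹, A⁻¹, -(r⁻¹ • rot A⁻¹ b), -θ, inv_pos.2 hr, fun t => ?_, fun t => ?_⟩
    · rw [h, rot_add, rot_smul, rot_inv_rot, smul_add, smul_smul, inv_mul_cancel₀ hr.ne',
        one_smul, add_neg_cancel_right]
    · rw [FramedLoop.twist_twist hr h hV, rot_inv_rot, add_neg_cancel, FramedLoop.twist_zero]
  trans := by
    rintro p₁ p₂ p₃ ⟨r, A, b, θ, hr, h, hV⟩ ⟨s, B, c, φ, hs, k, kV⟩
    refine ⟨s * r, B * A, s • rot B b + c, θ + φ, mul_pos hs hr, fun t => ?_, fun t => ?_⟩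
    · rw [k, h, rot_add, rot_smul, rot_mul, smul_add, smul_smul, add_assoc]
    · rw [kV, FramedLoop.twist_twist hr h hV, rot_mul]

instance ImmersedLoop.similarSetoid : Setoid ImmersedLoop :=
  ⟨ImmersedLoop.Similar, ImmersedLoop.similar_equivalence⟩

instance FramedLoop.similarSetoid : Setoid FramedLoop :=
  ⟨FramedLoop.Similar, FramedLoop.similar_equivalence⟩

/-! ### The moduli spaces and curve framing algorithms -/

/-- The moduli space `ℬ = Imm(S¹, ℝ³) / Sim` of unframed loops, with the quotient topology. -/
def ModuliLoops : Type := Quotient ImmersedLoop.similarSetoid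

instance : TopologicalSpace ModuliLoops :=
  inferInstanceAs (TopologicalSpace (Quotient ImmersedLoop.similarSetoid))

/-- The moduli space `ℳ = {relatively framed loops} / Sim` of framed loops, with the quotient
topology. -/
def ModuliFramedLoops : Type := Quotient FramedLoop.similarSetoid

instance : TopologicalSpace ModuliFramedLoops :=
  inferInstanceAs (TopologicalSpace (Quotient FramedLoop.similarSetoid))

/-- The forget-framing map `ℳ → ℬ`, `[γ, V] ↦ [γ]`. -/
def forgetFraming : ModuliFramedLoops → ModuliLoops :=
  Quotient.map FramedLoop.base fun _ _ ⟨r, A, b, _, hr, h, _⟩ => ⟨r, A, b, hr, h⟩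

/-- A curve framing algorithm defined on a subset `U` of `ℬ`: a continuous section over `U` of
the forget-framing map `ℳ → ℬ`. -/
def IsCurveFramingAlgorithm (U : Set ModuliLoops) (s : U → ModuliFramedLoops) : Prop :=
  Continuous s ∧ ∀ b : U, forgetFraming (s b) = b

end FramedCurves

end

/-! A section would frame the normal planes of all loops in the circle of loops `halfTurn u`, up to
a rotation that is constant along each loop. The unit tangents of this family map the torus of pairs
(u, t) to the sphere with degree ±1, and the normal planes form the pullback of the tangent bundle
of the sphere, whose Euler number is then ±2. Normalising the framings at one time t removes the
ambiguity and would trivialise this bundle, which is impossible.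

The obstruction is computed with winding numbers in u. The tangents of a loop determine two axes,
which for the family are √3 e₁ and √3 e₃. Their complex coordinates in the frame, times the
conjugate coordinate of the second axis at t = 3/2, are unaffected by similarities and twists, so a
section turns them into continuous functions F and G on the torus.

G can vanish only where the tangent is ±e₃, hence only at t = 1/2 modulo 2. As G = 3 at t = 3/2, its
winding number is 0 at t = 1/3 and at t = 2/3. F has no zero for t in [1/3, 2/3], so it has one
winding number m at both ends. But G · conj F depends only on the tangent
(`FramedLoop.invariants_of_similar_halfTurn`) and has winding number -1 at t = 1/3 and +1 at t = 2/3
(`FramedLoop.re_pos_of_similar_halfTurn`), so that m = 1 and m = -1. -/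

open scoped ComplexConjugate

/-! ### Winding numbers of periodic functions. -/

/-- `f : ℝ → ℂ` has a continuous logarithm that grows by `2πi n` over each period `2π`. -/
def HasWinding (f : ℝ → ℂ) (n : ℤ) : Prop :=
  ∃ g : ℝ → ℂ, Continuous g ∧ (∀ u, Complex.exp (g u) = f u) ∧
    ∀ u, g (u + 2 * Real.pi) = g u + n * (2 * Real.pi * Complex.I)

/-- A continuous function with values in `2πiℤ` on a preconnected space is constant. -/
theorem exists_int_of_exp_eq_one {X : Type*} [TopologicalSpace X] [PreconnectedSpace X]
    [Nonempty X] {g : X → ℂ} (hg : Continuous g) (h : ∀ x, Complex.exp (g x) = 1) :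
    ∃ n : ℤ, ∀ x, g x = n * (2 * Real.pi * Complex.I) := by
  choose k hk using fun x => Complex.exp_eq_one_iff.1 (h x)
  have hk' : ∀ x, (k x : ℝ) = (g x).im / (2 * Real.pi) := fun x => by
    have := congrArg Complex.im (hk x)
    simp at this
    rw [this]; field_simp
  have hc : Continuous k := by
    rw [Int.isClosedEmbedding_coe_real.isEmbedding.continuous_iff]
    have : ((↑) : ℤ → ℝ) ∘ k = fun x => (g x).im / (2 * Real.pi) := funext hk'
    rw [this]
    exact (Complex.continuous_im.comp hg).div_const _
  obtain ⟨x₀⟩ := ‹Nonempty X›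
  refine ⟨k x₀, fun x => ?_⟩
  rw [hk x, PreconnectedSpace.constant ‹_› hc (x := x) (y := x₀)]

theorem HasWinding.unique {f : ℝ → ℂ} {m n : ℤ} (hm : HasWinding f m) (hn : HasWinding f n) :
    m = n := by
  obtain ⟨g, hg, hgf, hgm⟩ := hm
  obtain ⟨k, hk, hkf, hkn⟩ := hn
  obtain ⟨d, hd⟩ := exists_int_of_exp_eq_one (hg.sub hk) fun u => by
    rw [Pi.sub_apply, Complex.exp_sub, hgf, hkf, div_self (hkf u ▸ Complex.exp_ne_zero _)]
  have h0 := hd 0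
  have h1 := hd (0 + 2 * Real.pi)
  simp only [Pi.sub_apply] at h0 h1
  rw [hgm, hkn] at h1
  have h2 : ((m : ℂ) - n) * (2 * Real.pi * Complex.I) = 0 := by linear_combination h1 - h0
  have h3 := (mul_eq_zero.1 h2).resolve_right Complex.two_pi_I_ne_zero
  exact_mod_cast sub_eq_zero.1 h3

theorem HasWinding.mul {f g : ℝ → ℂ} {m n : ℤ} (hf : HasWinding f m) (hg : HasWinding g n) :
    HasWinding (fun u => f u * g u) (m + n) := by
  obtain ⟨a, ha, haf, ham⟩ := hf
  obtain ⟨b, hb, hbf, hbm⟩ := hg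
  refine ⟨fun u => a u + b u, ha.add hb, fun u => by rw [Complex.exp_add, haf, hbf], fun u => ?_⟩
  simp only [ham, hbm]; push_cast; ring

theorem HasWinding.conj {f : ℝ → ℂ} {m : ℤ} (hf : HasWinding f m) :
    HasWinding (fun u => conj (f u)) (-m) := by
  obtain ⟨a, ha, haf, ham⟩ := hf
  refine ⟨fun u => conj (a u), Complex.continuous_conj.comp ha, fun u => ?_, fun u => ?_⟩
  · simp only [← haf, Complex.exp_conj]
  · simp [ham, map_ofNat]

theorem hasWinding_of_mem_slitPlane {f : ℝ → ℂ} (hf : Continuous f)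
    (hp : Function.Periodic f (2 * Real.pi)) (h : ∀ u, f u ∈ Complex.slitPlane) :
    HasWinding f 0 :=
  ⟨fun u => Complex.log (f u), hf.clog h,
    fun u => Complex.exp_log (Complex.slitPlane_ne_zero (h u)), fun u => by simp [hp u]⟩

theorem hasWinding_cexp (n : ℤ) : HasWinding (fun u => Complex.exp (n * u * Complex.I)) n :=
  ⟨fun u => n * u * Complex.I, by fun_prop, fun _ => rfl, fun u => by push_cast; ring⟩

/-- The winding number is invariant under homotopy. -/
theorem exists_hasWinding {F : ℝ → ℝ → ℂ} (hF : Continuous F.uncurry) {a b : ℝ} (hab : a ≤ b)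
    (hp : ∀ t, Function.Periodic (F · t) (2 * Real.pi))
    (h : ∀ u, ∀ t ∈ Set.Icc a b, F u t ≠ 0) :
    ∃ n : ℤ, ∀ t ∈ Set.Icc a b, HasWinding (F · t) n := by
  -- Clamping the time to [a, b] makes the function nonzero on the whole plane, which is simply
  -- connected, so it lifts through the covering `exp`.
  let c : ℝ → ℝ := fun t => Set.projIcc a b hab t
  have hc : Continuous c := continuous_subtype_val.comp continuous_projIcc
  have hcm : ∀ t, c t ∈ Set.Icc a b := fun t => (Set.projIcc a b hab t).2
  let f : C(ℝ × ℝ, ℂ) := ⟨fun x => F x.1 (c x.2),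
    hF.comp (continuous_fst.prodMk (hc.comp continuous_snd))⟩
  obtain ⟨G, ⟨-, hG⟩, -⟩ := Complex.isCoveringMapOn_exp.existsUnique_continuousMap_lifts f
    (a₀ := (0, 0)) (e₀ := Complex.log (f (0, 0)))
    (Complex.exp_log (h _ _ (hcm _))) (fun x => h _ _ (hcm _))
  have hG' : ∀ u t, Complex.exp (G (u, t)) = F u (c t) := fun u t => congrFun hG (u, t)
  -- The increment of the lift over a period lies in 2πiℤ for all (u, t) at once, hence is a single
  -- constant.
  obtain ⟨n, hn⟩ := exists_int_of_exp_eq_one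
    (g := fun x : ℝ × ℝ => G (x.1 + 2 * Real.pi, x.2) - G x) (by fun_prop) fun x => by
      rw [Complex.exp_sub, hG', hG', show F (x.1 + 2 * Real.pi) (c x.2) = F x.1 (c x.2) from
        hp (c x.2) x.1, div_self (h _ _ (hcm _))]
  refine ⟨n, fun t ht => ⟨fun u => G (u, t), by fun_prop, fun u => ?_, fun u => ?_⟩⟩
  · rw [hG']; simp only [c, Set.projIcc_of_mem hab ht]
  · linear_combination hn (u, t)

theorem hasWinding_const {z : ℂ} (hz : z ∈ Complex.slitPlane) : HasWinding (fun _ => z) 0 :=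
  hasWinding_of_mem_slitPlane continuous_const (fun _ => rfl) fun _ => hz

/-- A loop within the open half-plane around `-i e^{-inu}` for every `u` has winding number `-n`. -/
theorem HasWinding.eq_neg_of_re_pos {f : ℝ → ℂ} {k n : ℤ} (hk : HasWinding f k)
    (hf : Continuous f) (hp : Function.Periodic f (2 * Real.pi))
    (h : ∀ u : ℝ, 0 < (Complex.I * f u * Complex.exp (n * u * Complex.I)).re) : k = -n := by
  have hI : Complex.I ∈ Complex.slitPlane := by simp [Complex.mem_slitPlane_iff]
  -- This product has winding number 0 + k + n, and also 0 because it stays in the right half-plane.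
  have hw := ((hasWinding_const hI).mul hk).mul (hasWinding_cexp n)
  have hper : Function.Periodic
      (fun u : ℝ => Complex.I * f u * Complex.exp (n * u * Complex.I)) (2 * Real.pi) := fun u => by
    have e : Complex.exp (n * ((u + 2 * Real.pi : ℝ) : ℂ) * Complex.I) =
        Complex.exp (n * u * Complex.I) := by
      rw [Complex.exp_eq_exp_iff_exists_int]
      exact ⟨n, by push_cast; ring⟩
    simp only [e, hp u]
  have hw' := hasWinding_of_mem_slitPlane (by fun_prop) hper
    fun u => Complex.mem_slitPlane_iff.2 (Or.inl (h u))
  have := hw.unique hw'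
  omega

/-! ### Frame coordinates and invariants of framed loops. -/

noncomputable section

namespace FramedCurves

theorem rot_sub (A : SO3) (u v : E3) : rot A (u - v) = rot A u - rot A v := by
  ext i; simp [rot, Matrix.mulVec_sub]

theorem continuous_cross {X : Type*} [TopologicalSpace X] {f g : X → E3} (hf : Continuous f)
    (hg : Continuous g) : Continuous fun x => cross (f x) (g x) := by
  have hf' : ∀ i, Continuous fun x => (f x).ofLp i := fun i => by fun_prop
  have hg' : ∀ i, Continuous fun x => (g x).ofLp i := fun i => by fun_prop
  refine (PiLp.continuous_toLp 2 _).comp (continuous_pi fun i => ?_)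
  fin_cases i <;> simp [crossProduct] <;> fun_prop

/-- The complex coordinate of `v` in the orthonormal frame `(V, T × V)` of the plane
orthogonal to `T`. -/
def frameCoord (T V v : E3) : ℂ := ⟨inner ℝ v V, inner ℝ v (cross T V)⟩

theorem frameCoord_rot (A : SO3) (T V v : E3) :
    frameCoord (rot A T) (rot A V) (rot A v) = frameCoord T V v := by
  simp only [frameCoord, ← rot_cross, inner_rot]

/-- Since T × (T × V) = -V, the twist is a rotation of the frame by α, so coordinates turn by -α. -/
theorem frameCoord_twist {T V : E3} (hT : ‖T‖ = 1) (hTV : inner ℝ V T = 0) (α : ℝ) (v : E3) :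
    frameCoord T (Real.cos α • V + Real.sin α • cross T V) v
      = Complex.exp (-α * Complex.I) * frameCoord T V v := by
  rw [frameCoord, cross_add, cross_smul, cross_smul, cross_cross_of_orth hT hTV, Complex.exp_mul_I]
  apply Complex.ext <;>
  simp [frameCoord, inner_add_right, inner_smul_right, ← Complex.ofReal_cos,
    ← Complex.ofReal_sin]

/-- The Hermitian product of two frame coordinates does not depend on the framing. -/
theorem frameCoord_mul_conj {T V : E3} (hT : ‖T‖ = 1) (hV : ‖V‖ = 1) (hTV : inner ℝ V T = 0)
    (v w : E3) :
    frameCoord T V v * conj (frameCoord T V w)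
      = ⟨inner ℝ v w - inner ℝ v T * inner ℝ w T, inner ℝ (cross w v) T⟩ := by
  have h1 : inner ℝ T T = 1 := by rw [real_inner_self_eq_norm_sq, hT, one_pow]
  have h2 : inner ℝ V V = 1 := by rw [real_inner_self_eq_norm_sq, hV, one_pow]
  obtain ⟨W, hW⟩ : ∃ W, W = cross T V := ⟨_, rfl⟩
  have hWi : W.ofLp 0 = T.ofLp 1 * V.ofLp 2 - T.ofLp 2 * V.ofLp 1 ∧
      W.ofLp 1 = T.ofLp 2 * V.ofLp 0 - T.ofLp 0 * V.ofLp 2 ∧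
      W.ofLp 2 = T.ofLp 0 * V.ofLp 1 - T.ofLp 1 * V.ofLp 0 := by
    rw [hW]; simp [cross, crossProduct]
  obtain ⟨w0, w1, w2⟩ := hWi
  rw [inner_eq_dot] at h1 h2 hTV
  simp only [dotProduct, Fin.sum_univ_three] at h1 h2 hTV
  generalize hT0 : T.ofLp 0 = T0 at *
  generalize hT1 : T.ofLp 1 = T1 at *
  generalize hT2 : T.ofLp 2 = T2 at *
  generalize hV0 : V.ofLp 0 = V0 at *
  generalize hV1 : V.ofLp 1 = V1 at *
  generalize hV2 : V.ofLp 2 = V2 at *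
  let M : Matrix (Fin 3) (Fin 3) ℝ := !![T0, T1, T2; V0, V1, V2; W.ofLp 0, W.ofLp 1, W.ofLp 2]
  have hM : M * M.transpose = 1 := by
    ext i j
    fin_cases i <;> fin_cases j <;> simp [M, Matrix.mul_apply, Fin.sum_univ_three, w0, w1, w2]
    · linear_combination h1
    · linear_combination hTV
    · ring
    · linear_combination hTV
    · linear_combination h2
    · ring
    · ring
    · ring
    · linear_combination (V0 * V0 + V1 * V1 + V2 * V2) * h1 + h2 -
        (V0 * T0 + V1 * T1 + V2 * T2) * hTV
  -- The rows T, V, W are orthonormal, so the columns are too. The entries of this relation are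
  -- Parseval's identity, which gives the real part.
  have hM' := mul_eq_one_comm.1 hM
  have e : ∀ i j, (M.transpose * M) i j = (1 : Matrix (Fin 3) (Fin 3) ℝ) i j := fun i j => by
    rw [hM']
  have e00 := e 0 0
  have e01 := e 0 1
  have e02 := e 0 2
  have e11 := e 1 1
  have e12 := e 1 2
  have e22 := e 2 2
  simp [M, Matrix.mul_apply, Fin.sum_univ_three] at e00 e01 e02 e11 e12 e22
  -- T = V × W turns the imaginary part into a triple product.
  have hT' : T0 = V1 * W.ofLp 2 - V2 * W.ofLp 1 ∧ T1 = V2 * W.ofLp 0 - V0 * W.ofLp 2 ∧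
      T2 = V0 * W.ofLp 1 - V1 * W.ofLp 0 := by
    rw [w0, w1, w2]
    refine ⟨?_, ?_, ?_⟩
    · linear_combination V0 * hTV - T0 * h2
    · linear_combination V1 * hTV - T1 * h2
    · linear_combination V2 * hTV - T2 * h2
  obtain ⟨t0, t1, t2⟩ := hT'
  simp only [frameCoord, ← hW, inner_eq_dot, dotProduct, Fin.sum_univ_three]
  clear_value M
  clear hM hM' e w0 w1 w2 hW
  apply Complex.ext
  · simp [hT0, hT1, hT2, hV0, hV1, hV2]
    linear_combination v.ofLp 0 * w.ofLp 0 * e00 + v.ofLp 1 * w.ofLp 1 * e11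
      + v.ofLp 2 * w.ofLp 2 * e22 + (v.ofLp 0 * w.ofLp 1 + v.ofLp 1 * w.ofLp 0) * e01
      + (v.ofLp 0 * w.ofLp 2 + v.ofLp 2 * w.ofLp 0) * e02
      + (v.ofLp 1 * w.ofLp 2 + v.ofLp 2 * w.ofLp 1) * e12
  · simp [cross, crossProduct, hT0, hT1, hT2, hV0, hV1, hV2]
    linear_combination - (w.ofLp 1 * v.ofLp 2 - w.ofLp 2 * v.ofLp 1) * t0
      - (w.ofLp 2 * v.ofLp 0 - w.ofLp 0 * v.ofLp 2) * t1
      - (w.ofLp 0 * v.ofLp 1 - w.ofLp 1 * v.ofLp 0) * t2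

/-- A vector determined by the tangents of a curve. -/
def firstAxis (T : ℝ → E3) : E3 := T (1 / 6) - T (5 / 6)

/-- A second vector determined by the tangents of a curve, orthogonal to the first one. -/
def secondAxis (T : ℝ → E3) : E3 := cross (firstAxis T) (T (3 / 2))

/-- The complex coordinate of `v` in the frame of `p` at time `t`. -/
def FramedLoop.coord (p : FramedLoop) (t : ℝ) (v : E3) : ℂ :=
  frameCoord (p.base.tangent t) (p.framing t) v

/-- The frame coordinate of the first axis, relative to that of the second axis at
time `3 / 2`. It is unchanged by similarities and constant twists. -/
def FramedLoop.firstInvariant (p : FramedLoop) (t : ℝ) : ℂ :=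
  p.coord t (firstAxis p.base.tangent) * conj (p.coord (3 / 2) (secondAxis p.base.tangent))

/-- The frame coordinate of the second axis, relative to that of the second axis at
time `3 / 2`. It is unchanged by similarities and constant twists. -/
def FramedLoop.secondInvariant (p : FramedLoop) (t : ℝ) : ℂ :=
  p.coord t (secondAxis p.base.tangent) * conj (p.coord (3 / 2) (secondAxis p.base.tangent))

theorem FramedLoop.coord_mul_conj (p : FramedLoop) (t : ℝ) (v w : E3) :
    p.coord t v * conj (p.coord t w) =
      ⟨inner ℝ v w - inner ℝ v (p.base.tangent t) * inner ℝ w (p.base.tangent t),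
        inner ℝ (cross w v) (p.base.tangent t)⟩ :=
  frameCoord_mul_conj (p.base.norm_tangent t) (p.2.2.1 t) (p.inner_tangent t) v w

theorem firstAxis_rot {T S : ℝ → E3} {A : SO3} (h : ∀ t, S t = rot A (T t)) :
    firstAxis S = rot A (firstAxis T) := by
  rw [firstAxis, firstAxis, h, h, rot_sub]

theorem secondAxis_rot {T S : ℝ → E3} {A : SO3} (h : ∀ t, S t = rot A (T t)) :
    secondAxis S = rot A (secondAxis T) := by
  rw [secondAxis, secondAxis, firstAxis_rot h, h, rot_cross]

/-- The rotation moves tangent, frame and vector together and drops out; only the twist by 2θ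
survives, as a unit scalar independent of t. -/
theorem FramedLoop.coord_of_similar {p q : FramedLoop} {r : ℝ} {A : SO3} {b : E3} {θ : ℝ}
    (hr : 0 < r) (hb : ∀ t, q.base.1 t = r • rot A (p.base.1 t) + b)
    (hV : ∀ t, q.framing t = rot A (p.twist θ t)) (t : ℝ) (v : E3) :
    q.coord t (rot A v) = Complex.exp (-(2 * θ : ℝ) * Complex.I) * p.coord t v := by
  rw [coord, hV, ImmersedLoop.tangent_eq hr hb, frameCoord_rot, twist,
    frameCoord_twist (p.base.norm_tangent t) (p.inner_tangent t), coord]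

theorem exp_mul_conj_exp (α : ℝ) (z w : ℂ) :
    Complex.exp (-α * Complex.I) * z * conj (Complex.exp (-α * Complex.I) * w) = z * conj w := by
  have : Complex.exp (-α * Complex.I) * conj (Complex.exp (-α * Complex.I)) = 1 := by
    rw [← Complex.exp_conj, ← Complex.exp_add]; simp
  rw [map_mul]
  linear_combination z * conj w * this

/-- The axes rotate along with the tangents, and the unit scalar of the twist cancels against its
conjugate. -/
theorem FramedLoop.firstInvariant_eq_of_similar {p q : FramedLoop} (h : FramedLoop.Similar p q) :
    p.firstInvariant = q.firstInvariant := by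
  obtain ⟨r, A, b, θ, hr, hb, hV⟩ := h
  have hT := ImmersedLoop.tangent_eq hr hb
  funext t
  rw [firstInvariant, firstInvariant, firstAxis_rot hT, secondAxis_rot hT,
    coord_of_similar hr hb hV, coord_of_similar hr hb hV, exp_mul_conj_exp]

theorem FramedLoop.secondInvariant_eq_of_similar {p q : FramedLoop} (h : FramedLoop.Similar p q) :
    p.secondInvariant = q.secondInvariant := by
  obtain ⟨r, A, b, θ, hr, hb, hV⟩ := h
  have hT := ImmersedLoop.tangent_eq hr hb
  funext t
  rw [secondInvariant, secondInvariant, secondAxis_rot hT,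
    coord_of_similar hr hb hV, coord_of_similar hr hb hV, exp_mul_conj_exp]

/-! ### Continuity of the invariants and descent to the moduli space. -/

theorem continuous_iteratedDeriv_eval (n : ℕ) :
    Continuous fun x : SmoothLoop × ℝ => iteratedDeriv n x.1 x.2 := by
  have h : Continuous fun γ : SmoothLoop => γ.jet n :=
    (continuous_apply (A := fun _ : ℕ => C(ℝ, E3)) n).comp
      (continuous_induced_dom (f := SmoothLoop.jet))
  exact ContinuousEval.continuous_eval.comp (h.prodMap continuous_id)

theorem FramedLoop.continuous_framing :
    Continuous fun x : FramedLoop × ℝ => x.1.framing x.2 := by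
  have h0 : Continuous FramedLoop.framing := continuous_snd.comp continuous_subtype_val
  have h := (continuous_iteratedDeriv_eval 0).comp
    ((h0.comp continuous_fst).prodMk continuous_snd :
      Continuous fun x : FramedLoop × ℝ => (x.1.framing, x.2))
  simpa only [iteratedDeriv_zero, Function.comp_def] using h

theorem FramedLoop.continuous_tangent :
    Continuous fun x : FramedLoop × ℝ => x.1.base.tangent x.2 := by
  have h0 : Continuous fun p : FramedLoop => p.base.1 :=
    continuous_fst.comp continuous_subtype_val
  have h := (continuous_iteratedDeriv_eval 1).comp
    ((h0.comp continuous_fst).prodMk continuous_snd :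
      Continuous fun x : FramedLoop × ℝ => (x.1.base.1, x.2))
  have h' : Continuous fun x : FramedLoop × ℝ => deriv x.1.base.1 x.2 := by
    simpa only [iteratedDeriv_one, Function.comp_def] using h
  exact (h'.norm.inv₀ fun x => norm_ne_zero_iff.2 (x.1.base.2 x.2)).smul h'

theorem FramedLoop.continuous_tangent_const (t : ℝ) :
    Continuous fun p : FramedLoop => p.base.tangent t := by
  have h : Continuous fun p : FramedLoop => (p, t) := .prodMk_left t
  have h' := continuous_tangent.comp h
  simpa only [Function.comp_def] using h'

theorem FramedLoop.continuous_coord {X : Type*} [TopologicalSpace X] {p : X → FramedLoop}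
    {t : X → ℝ} {v : X → E3} (hp : Continuous p) (ht : Continuous t) (hv : Continuous v) :
    Continuous fun x => (p x).coord (t x) (v x) := by
  have hT := continuous_tangent.comp (hp.prodMk ht)
  have hV := continuous_framing.comp (hp.prodMk ht)
  have h1 := hv.inner (𝕜 := ℝ) hV
  have h2 := hv.inner (𝕜 := ℝ) (continuous_cross hT hV)
  exact Complex.equivRealProdCLM.symm.continuous.comp (h1.prodMk h2)

theorem FramedLoop.continuous_firstAxis :
    Continuous fun p : FramedLoop => firstAxis p.base.tangent :=
  (continuous_tangent_const _).sub (continuous_tangent_const _)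

theorem FramedLoop.continuous_secondAxis :
    Continuous fun p : FramedLoop => secondAxis p.base.tangent :=
  continuous_cross continuous_firstAxis (continuous_tangent_const _)

theorem FramedLoop.continuous_firstInvariant :
    Continuous fun x : FramedLoop × ℝ => x.1.firstInvariant x.2 :=
  (continuous_coord continuous_fst continuous_snd (continuous_firstAxis.comp continuous_fst)).mul
    (Complex.continuous_conj.comp (continuous_coord continuous_fst continuous_const
      (continuous_secondAxis.comp continuous_fst)))

theorem FramedLoop.continuous_secondInvariant :
    Continuous fun x : FramedLoop × ℝ => x.1.secondInvariant x.2 :=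
  (continuous_coord continuous_fst continuous_snd (continuous_secondAxis.comp continuous_fst)).mul
    (Complex.continuous_conj.comp (continuous_coord continuous_fst continuous_const
      (continuous_secondAxis.comp continuous_fst)))

/-- A continuous function of a framed loop and a time that is invariant under similarities
descends to a jointly continuous function on the moduli space. -/
theorem exists_continuous_descend {I : FramedLoop → ℝ → ℂ}
    (hI : Continuous fun x : FramedLoop × ℝ => I x.1 x.2)
    (h : ∀ p q, FramedLoop.Similar p q → I p = I q) :
    ∃ J : ModuliFramedLoops → ℝ → ℂ, Continuous J.uncurry ∧
      ∀ p : FramedLoop, J (Quotient.mk _ p : Quotient FramedLoop.similarSetoid) = I p := by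
  -- Currying the time leaves a map on framed loops alone to descend; a product of a quotient map
  -- with ℝ never has to be a quotient map.
  let c : C(FramedLoop, C(ℝ, ℂ)) := ContinuousMap.curry ⟨fun x : FramedLoop × ℝ => I x.1 x.2, hI⟩
  have hc : ∀ p q : FramedLoop, p ≈ q → c p = c q := fun p q hpq =>
    ContinuousMap.ext fun t => congrFun (h p q hpq) t
  let d : ModuliFramedLoops → C(ℝ, ℂ) := Quotient.lift c hc
  have hd : Continuous d := c.continuous.quotient_lift hc
  exact ⟨fun m t => d m t,
    ContinuousEval.continuous_eval.comp (hd.prodMap continuous_id), fun p => rfl⟩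

theorem FramedLoop.invariant_periodic (p : FramedLoop) (t : ℝ) :
    p.firstInvariant (t + 2) = p.firstInvariant t ∧
      p.secondInvariant (t + 2) = p.secondInvariant t := by
  have h1 : p.framing (t + 2) = p.framing t := p.framing.periodic t
  have h2 : p.base.tangent (t + 2) = p.base.tangent t := by
    have : deriv p.base.1 (t + 2) = deriv p.base.1 t := by
      rw [← deriv_comp_add_const, show (fun x => p.base.1 (x + 2)) = p.base.1.toFun from
        funext p.base.1.periodic]
    simp only [ImmersedLoop.tangent, this]
  simp only [firstInvariant, secondInvariant, coord, h1, h2, and_self]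

end FramedCurves

end

/-! ### A circle of immersed loops. -/

noncomputable section

namespace FramedCurves

/-- The one-parameter family of loops `α + cos u β + sin u δ`. -/
def SmoothLoop.rotate (α β δ : SmoothLoop) (u : ℝ) : SmoothLoop where
  toFun t := α t + (Real.cos u • β t + Real.sin u • δ t)
  smooth := α.smooth.add ((β.smooth.const_smul _).add (δ.smooth.const_smul _))
  periodic t := by simp only [α.periodic t, β.periodic t, δ.periodic t]

theorem SmoothLoop.jet_rotate (α β δ : SmoothLoop) (u : ℝ) (n : ℕ) :
    (SmoothLoop.rotate α β δ u).jet n =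
      α.jet n + (Real.cos u • β.jet n + Real.sin u • δ.jet n) := by
  have h : ∀ (γ : SmoothLoop) t, ContDiffAt ℝ n γ.toFun t := fun γ t =>
    (γ.smooth.of_le (by exact_mod_cast le_top)).contDiffAt
  ext1 t
  have hβ : ContDiffAt ℝ n (Real.cos u • β.toFun) t := (h β t).const_smul (Real.cos u)
  have hδ : ContDiffAt ℝ n (Real.sin u • δ.toFun) t := (h δ t).const_smul (Real.sin u)
  have hβδ : ContDiffAt ℝ n (Real.cos u • β.toFun + Real.sin u • δ.toFun) t := hβ.add hδ
  change iteratedDeriv n (α.toFun + (Real.cos u • β.toFun + Real.sin u • δ.toFun)) t = _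
  rw [iteratedDeriv_add (h α t) hβδ, iteratedDeriv_add hβ hδ,
    iteratedDeriv_const_smul (h β t), iteratedDeriv_const_smul (h δ t)]
  rfl

theorem SmoothLoop.continuous_rotate (α β δ : SmoothLoop) :
    Continuous (SmoothLoop.rotate α β δ) := by
  refine continuous_induced_rng.2 (continuous_pi fun n => ?_)
  simp only [Function.comp_def, jet_rotate]
  fun_prop

/-- A smooth loop given by its three coordinates. -/
def coordLoop (x y z : ℝ → ℝ) (hx : ContDiff ℝ ∞ x) (hy : ContDiff ℝ ∞ y) (hz : ContDiff ℝ ∞ z)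
    (px : Function.Periodic x 2) (py : Function.Periodic y 2) (pz : Function.Periodic z 2) :
    SmoothLoop where
  toFun t := !₂[x t, y t, z t]
  smooth := by
    rw [contDiff_euclidean]
    intro i
    fin_cases i
    exacts [hx, hy, hz]
  periodic t := by simp only [px t, py t, pz t]

theorem sin_pi_mul_periodic : Function.Periodic (fun t : ℝ => Real.sin (Real.pi * t)) 2 :=
  fun t => by
    simp only [mul_add, mul_comm Real.pi 2, Real.sin_add_two_pi]

theorem cos_pi_mul_periodic : Function.Periodic (fun t : ℝ => Real.cos (Real.pi * t)) 2 :=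
  fun t => by
    simp only [mul_add, mul_comm Real.pi 2, Real.cos_add_two_pi]

/-- The coordinate function carried around the first axis by the family. -/
def movingCoord (t : ℝ) : ℝ :=
  (-Real.cos (Real.pi * t) - Real.sin (Real.pi * t) * Real.cos (Real.pi * t)) / 2

/-- The coordinate function that stays fixed in the family. -/
def fixedCoord (t : ℝ) : ℝ :=
  (Real.cos (Real.pi * t) - Real.sin (Real.pi * t) * Real.cos (Real.pi * t)) / 2

theorem contDiff_movingCoord : ContDiff ℝ ∞ movingCoord := by unfold movingCoord; fun_prop

theorem contDiff_fixedCoord : ContDiff ℝ ∞ fixedCoord := by unfold fixedCoord; fun_prop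

theorem movingCoord_periodic : Function.Periodic movingCoord 2 := fun t => by
  have h1 := sin_pi_mul_periodic t
  have h2 := cos_pi_mul_periodic t
  simp only at h1 h2
  simp only [movingCoord, h1, h2]

theorem fixedCoord_periodic : Function.Periodic fixedCoord 2 := fun t => by
  have h1 := sin_pi_mul_periodic t
  have h2 := cos_pi_mul_periodic t
  simp only at h1 h2
  simp only [fixedCoord, h1, h2]

/-- A closed one-parameter family of loops, in which one half of the loop is turned once around
the first axis while the other half stays fixed. -/
def halfTurnLoop (u : ℝ) : SmoothLoop :=
  SmoothLoop.rotate
    (coordLoop (fun t => Real.sin (Real.pi * t)) fixedCoord (fun _ => 0) (by fun_prop)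
      contDiff_fixedCoord contDiff_const sin_pi_mul_periodic fixedCoord_periodic fun _ => rfl)
    (coordLoop (fun _ => 0) movingCoord (fun _ => 0) contDiff_const contDiff_movingCoord
      contDiff_const (fun _ => rfl) movingCoord_periodic fun _ => rfl)
    (coordLoop (fun _ => 0) (fun _ => 0) movingCoord contDiff_const contDiff_const
      contDiff_movingCoord (fun _ => rfl) (fun _ => rfl) movingCoord_periodic) u

/-- The direction of `halfTurnLoop`, in terms of `u` and of `c = cos (π t)`, `s = sin (π t)`. -/
def direction (u c s : ℝ) : E3 :=
  !₂[c, (2 * s ^ 2 - s - 1) / 2 + (2 * s ^ 2 + s - 1) / 2 * Real.cos u,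
    (2 * s ^ 2 + s - 1) / 2 * Real.sin u]

theorem hasDerivAt_of_coord {f : ℝ → E3} {f' : E3} {t : ℝ}
    (h : ∀ i, HasDerivAt (fun t => f t i) (f' i) t) : HasDerivAt f f' t := by
  have h1 : HasDerivAt (fun t => (f t).ofLp) f'.ofLp t := hasDerivAt_pi.2 h
  exact (PiLp.hasFDerivAt_toLp (𝕜 := ℝ) 2 (f t).ofLp).comp_hasDerivAt t h1

theorem hasDerivAt_halfTurnLoop (u t : ℝ) :
    HasDerivAt (halfTurnLoop u)
      (Real.pi • direction u (Real.cos (Real.pi * t)) (Real.sin (Real.pi * t))) t := by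
  have hm : HasDerivAt (fun t => Real.pi * t) Real.pi t := by
    simpa using (hasDerivAt_id t).const_mul Real.pi
  have hs := hm.sin
  have hc := hm.cos
  have h2 := Real.sin_sq_add_cos_sq (Real.pi * t)
  have hM : HasDerivAt movingCoord
      (Real.pi * ((2 * Real.sin (Real.pi * t) ^ 2 + Real.sin (Real.pi * t) - 1) / 2)) t := by
    refine ((hc.neg.sub (hs.mul hc)).div_const 2).congr_deriv ?_
    linear_combination (-Real.pi / 2) * h2
  have hF : HasDerivAt fixedCoord
      (Real.pi * ((2 * Real.sin (Real.pi * t) ^ 2 - Real.sin (Real.pi * t) - 1) / 2)) t := by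
    refine ((hc.sub (hs.mul hc)).div_const 2).congr_deriv ?_
    linear_combination (-Real.pi / 2) * h2
  refine hasDerivAt_of_coord fun i => ?_
  fin_cases i
  · refine (hs.add_const (Real.cos u * 0 + Real.sin u * 0)).congr_deriv ?_
    simp [direction, mul_comm]
  · refine (hF.add ((hM.const_mul (Real.cos u)).add_const (Real.sin u * 0))).congr_deriv ?_
    simp [direction]; ring
  · refine (((hM.const_mul (Real.sin u)).const_add (Real.cos u * 0)).const_add 0).congr_deriv ?_
    simp [direction]; ring

theorem norm_sq_direction (u c s : ℝ) :
    ‖direction u c s‖ ^ 2 = c ^ 2 +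
      ((2 * s ^ 2 - s - 1) / 2 + (2 * s ^ 2 + s - 1) / 2 * Real.cos u) ^ 2 +
      ((2 * s ^ 2 + s - 1) / 2 * Real.sin u) ^ 2 := by
  rw [EuclideanSpace.real_norm_sq_eq, Fin.sum_univ_three]
  simp [direction]

/-- A zero needs c = 0, so s = ±1; there the direction is (0, cos u, sin u) or (0, 1, 0). -/
theorem direction_ne_zero (u : ℝ) {c s : ℝ} (h : s ^ 2 + c ^ 2 = 1) : direction u c s ≠ 0 := by
  intro h0
  have h1 := norm_sq_direction u c s
  rw [h0, norm_zero] at h1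
  have hu := Real.sin_sq_add_cos_sq u
  have hc : c = 0 := by
    nlinarith [sq_nonneg c, sq_nonneg ((2 * s ^ 2 - s - 1) / 2 + (2 * s ^ 2 + s - 1) / 2 * Real.cos u),
      sq_nonneg ((2 * s ^ 2 + s - 1) / 2 * Real.sin u)]
  have hs : (s - 1) * (s + 1) = 0 := by rw [hc] at h; linear_combination h
  rcases mul_eq_zero.1 hs with hs | hs
  · obtain rfl : s = 1 := by linarith
    subst hc
    nlinarith
  · obtain rfl : s = -1 := by linarith
    subst hc
    norm_num at h1

/-- The closed family `halfTurnLoop` consists of immersions. -/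
def halfTurn (u : ℝ) : ImmersedLoop :=
  ⟨halfTurnLoop u, fun t => by
    rw [(hasDerivAt_halfTurnLoop u t).deriv]
    exact smul_ne_zero Real.pi_ne_zero (direction_ne_zero u (Real.sin_sq_add_cos_sq _))⟩

theorem continuous_halfTurn : Continuous halfTurn :=
  (SmoothLoop.continuous_rotate _ _ _).subtype_mk _

theorem halfTurn_periodic : Function.Periodic halfTurn (2 * Real.pi) := fun u =>
  Subtype.ext (by
    change halfTurnLoop (u + 2 * Real.pi) = halfTurnLoop u
    simp only [halfTurnLoop, SmoothLoop.rotate, Real.cos_add_two_pi, Real.sin_add_two_pi])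

theorem tangent_halfTurn (u t : ℝ) :
    (halfTurn u).tangent t =
      ‖direction u (Real.cos (Real.pi * t)) (Real.sin (Real.pi * t))‖⁻¹ •
        direction u (Real.cos (Real.pi * t)) (Real.sin (Real.pi * t)) := by
  have h : deriv (halfTurn u).1 t = _ := (hasDerivAt_halfTurnLoop u t).deriv
  rw [ImmersedLoop.tangent, h, norm_smul, Real.norm_of_nonneg Real.pi_pos.le, smul_smul]
  congr 1
  field_simp

theorem tangent_halfTurn_of_norm_eq_one {u t c s : ℝ} (hc : Real.cos (Real.pi * t) = c)
    (hs : Real.sin (Real.pi * t) = s) (h : ‖direction u c s‖ ^ 2 = 1) :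
    (halfTurn u).tangent t = direction u c s := by
  have : ‖direction u c s‖ = 1 := (pow_eq_one_iff_of_nonneg (norm_nonneg _) two_ne_zero).1 h
  rw [tangent_halfTurn, hc, hs, this, inv_one, one_smul]

/-- The coefficient 2s² + s - 1 of the moving part vanishes exactly at s = -1 and s = 1/2. So the
tangents at the times 3/2, 1/6 and 5/6 do not depend on u, and these times are used to define the
axes. -/
theorem tangent_halfTurn_three_halves (u : ℝ) :
    (halfTurn u).tangent (3 / 2) = !₂[0, 1, 0] := by
  have e : Real.pi * (3 / 2) = Real.pi / 2 + Real.pi := by ring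
  rw [tangent_halfTurn_of_norm_eq_one (c := 0) (s := -1)]
  · norm_num [direction]
  · rw [e, Real.cos_add_pi, Real.cos_pi_div_two, neg_zero]
  · rw [e, Real.sin_add_pi, Real.sin_pi_div_two]
  · rw [norm_sq_direction]; norm_num

theorem firstAxis_halfTurn (u : ℝ) : firstAxis (halfTurn u).tangent = !₂[√3, 0, 0] := by
  have h3 : √3 ^ 2 = (3 : ℝ) := Real.sq_sqrt (by norm_num)
  have e : Real.pi * (5 / 6) = Real.pi - Real.pi / 6 := by ring
  have e' : Real.pi * (1 / 6) = Real.pi / 6 := by ring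
  rw [firstAxis, tangent_halfTurn_of_norm_eq_one (c := √3 / 2) (s := 1 / 2),
    tangent_halfTurn_of_norm_eq_one (c := -(√3 / 2)) (s := 1 / 2)]
  · ext i
    fin_cases i <;> simp [direction]
  · rw [e, Real.cos_pi_sub, Real.cos_pi_div_six]
  · rw [e, Real.sin_pi_sub, Real.sin_pi_div_six]
  · rw [norm_sq_direction]; norm_num [div_pow, h3]
  · rw [e', Real.cos_pi_div_six]
  · rw [e', Real.sin_pi_div_six]
  · rw [norm_sq_direction]; norm_num [div_pow, h3]

theorem secondAxis_halfTurn (u : ℝ) : secondAxis (halfTurn u).tangent = !₂[0, 0, √3] := by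
  rw [secondAxis, firstAxis_halfTurn, tangent_halfTurn_three_halves]
  ext i
  fin_cases i <;> simp [cross, crossProduct]

end FramedCurves

end

/-! ### The invariants along the family. -/

namespace FramedCurves

/-- The invariants of a framing of `halfTurn u`, in terms of the unit tangent of the curve. -/
theorem FramedLoop.invariants_of_similar_halfTurn {p : FramedLoop} {u : ℝ}
    (h : ImmersedLoop.Similar p.base (halfTurn u)) (t : ℝ) :
    ((halfTurn u).tangent t 0 ^ 2 ≠ 1 → p.firstInvariant t ≠ 0) ∧
    ((halfTurn u).tangent t 2 ^ 2 ≠ 1 → p.secondInvariant t ≠ 0) ∧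
    p.secondInvariant (3 / 2) = 3 ∧
    p.secondInvariant t * conj (p.firstInvariant t) =
      -9 * ⟨(halfTurn u).tangent t 0 * (halfTurn u).tangent t 2, (halfTurn u).tangent t 1⟩ := by
  obtain ⟨r, A, b, hr, hA⟩ := h
  have hT := ImmersedLoop.tangent_eq hr hA
  have ha : rot A (firstAxis p.base.tangent) = !₂[√3, 0, 0] := by
    rw [← firstAxis_rot hT, firstAxis_halfTurn]
  have hc : rot A (secondAxis p.base.tangent) = !₂[0, 0, √3] := by
    rw [← secondAxis_rot hT, secondAxis_halfTurn]
  -- The Hermitian product is independent of the framing, so it can be evaluated on the model curve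
  -- after applying A.
  have key : ∀ t v w, p.coord t v * conj (p.coord t w) =
      ⟨inner ℝ (rot A v) (rot A w) - inner ℝ (rot A v) ((halfTurn u).tangent t) *
        inner ℝ (rot A w) ((halfTurn u).tangent t),
        inner ℝ (cross (rot A w) (rot A v)) ((halfTurn u).tangent t)⟩ := fun t v w => by
    rw [hT, ← rot_cross, inner_rot, inner_rot, inner_rot, inner_rot, coord_mul_conj]
  have h3 : √3 * √3 = (3 : ℝ) := Real.mul_self_sqrt (by norm_num)
  have hcc : ∀ t, p.coord t (secondAxis p.base.tangent) *
      conj (p.coord t (secondAxis p.base.tangent)) =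
      ((3 - 3 * (halfTurn u).tangent t 2 ^ 2 : ℝ) : ℂ) := fun t => by
    rw [key, hc]
    apply Complex.ext
    · simp only [inner_eq_dot, dotProduct, Fin.sum_univ_three]
      simp [-Complex.ofReal_sub]
      linear_combination (halfTurn u).tangent t 2 ^ 2 * h3
    · simp [inner_eq_dot, cross, crossProduct, dotProduct, Fin.sum_univ_three,
        -Complex.ofReal_sub]
  have haa : p.coord t (firstAxis p.base.tangent) *
      conj (p.coord t (firstAxis p.base.tangent)) =
      ((3 - 3 * (halfTurn u).tangent t 0 ^ 2 : ℝ) : ℂ) := by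
    rw [key, ha]
    apply Complex.ext
    · simp only [inner_eq_dot, dotProduct, Fin.sum_univ_three]
      simp [-Complex.ofReal_sub]
      linear_combination (halfTurn u).tangent t 0 ^ 2 * h3
    · simp [inner_eq_dot, cross, crossProduct, dotProduct, Fin.sum_univ_three,
        -Complex.ofReal_sub]
  have hca : p.coord t (secondAxis p.base.tangent) *
      conj (p.coord t (firstAxis p.base.tangent)) =
      -3 * ⟨(halfTurn u).tangent t 0 * (halfTurn u).tangent t 2, (halfTurn u).tangent t 1⟩ := by
    rw [key, ha, hc]
    apply Complex.ext
    · simp [inner_eq_dot, dotProduct, Fin.sum_univ_three]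
      linear_combination (halfTurn u).tangent t 0 * (halfTurn u).tangent t 2 * h3
    · simp [inner_eq_dot, cross, crossProduct, dotProduct, Fin.sum_univ_three]
  have h0 : p.secondInvariant (3 / 2) = 3 := by
    rw [secondInvariant, hcc, tangent_halfTurn_three_halves]
    simp
  have hne : conj (p.coord (3 / 2) (secondAxis p.base.tangent)) ≠ 0 :=
    right_ne_zero_of_mul (a := p.coord (3 / 2) (secondAxis p.base.tangent)) (by
      rw [← secondInvariant, h0]; norm_num)
  refine ⟨fun hx => mul_ne_zero (left_ne_zero_of_mul (haa.trans_ne ?_)) hne,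
    fun hz => mul_ne_zero (left_ne_zero_of_mul ((hcc t).trans_ne ?_)) hne, h0, ?_⟩
  · exact Complex.ofReal_ne_zero.2 fun h => hx (by linarith)
  · exact Complex.ofReal_ne_zero.2 fun h => hz (by linarith)
  · rw [secondInvariant] at h0
    rw [secondInvariant, firstInvariant, map_mul, Complex.conj_conj]
    -- The factor -9 is the -3 of `hca` times the squared modulus 3 of the normalising coordinate.
    linear_combination (p.coord t (secondAxis p.base.tangent) *
      conj (p.coord t (firstAxis p.base.tangent))) * h0 + 3 * hca

theorem sum_sq_tangent_halfTurn (u t : ℝ) : (halfTurn u).tangent t 0 ^ 2 +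
    (halfTurn u).tangent t 1 ^ 2 + (halfTurn u).tangent t 2 ^ 2 = 1 := by
  have h := EuclideanSpace.real_norm_sq_eq ((halfTurn u).tangent t)
  rw [ImmersedLoop.norm_tangent, Fin.sum_univ_three] at h
  linarith

theorem direction_eq_norm_smul_tangent (u t : ℝ) (i : Fin 3) :
    direction u (Real.cos (Real.pi * t)) (Real.sin (Real.pi * t)) i =
      ‖direction u (Real.cos (Real.pi * t)) (Real.sin (Real.pi * t))‖ *
        (halfTurn u).tangent t i := by
  have h := direction_ne_zero u (Real.sin_sq_add_cos_sq (Real.pi * t))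
  rw [tangent_halfTurn, PiLp.smul_apply, smul_eq_mul, mul_inv_cancel_left₀ (norm_ne_zero_iff.2 h)]

theorem tangent_halfTurn_two_sq_ne_one {u t : ℝ} (h : Real.sin (Real.pi * t) ≠ 1) :
    (halfTurn u).tangent t 2 ^ 2 ≠ 1 := by
  intro h1
  have hsum := sum_sq_tangent_halfTurn u t
  have h0 : (halfTurn u).tangent t 0 = 0 := by nlinarith
  have h1 : (halfTurn u).tangent t 1 = 0 := by nlinarith
  have d0 := direction_eq_norm_smul_tangent u t 0
  have d1 := direction_eq_norm_smul_tangent u t 1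
  rw [h0, mul_zero] at d0
  rw [h1, mul_zero] at d1
  simp only [direction, PiLp.toLp_apply, Matrix.cons_val] at d0 d1
  have hs := Real.sin_sq_add_cos_sq (Real.pi * t)
  have hs' : Real.sin (Real.pi * t) = -1 := by
    have : (Real.sin (Real.pi * t) - 1) * (Real.sin (Real.pi * t) + 1) = 0 := by
      rw [d0] at hs; linear_combination hs
    rcases mul_eq_zero.1 this with h2 | h2
    · exact absurd (by linarith) h
    · linarith
  rw [hs'] at d1
  norm_num at d1

/-- For such s the moving coefficient is positive, so a tangent ±e₁ forces sin u = 0. The second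
coordinate of the direction is then 2s² - 1 or -s, neither of which is zero. -/
theorem tangent_halfTurn_zero_sq_ne_one {u t : ℝ} (h : √3 / 2 ≤ Real.sin (Real.pi * t)) :
    (halfTurn u).tangent t 0 ^ 2 ≠ 1 := by
  intro h1
  have hsum := sum_sq_tangent_halfTurn u t
  have h1 : (halfTurn u).tangent t 1 = 0 := by nlinarith
  have h2 : (halfTurn u).tangent t 2 = 0 := by nlinarith
  have d1 := direction_eq_norm_smul_tangent u t 1
  have d2 := direction_eq_norm_smul_tangent u t 2
  rw [h1, mul_zero] at d1
  rw [h2, mul_zero] at d2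
  simp only [direction, PiLp.toLp_apply, Matrix.cons_val] at d1 d2
  have h3 : √3 ^ 2 = (3 : ℝ) := Real.sq_sqrt (by norm_num)
  have h3' : (1 : ℝ) < √3 := by nlinarith [Real.sqrt_nonneg 3]
  generalize Real.sin (Real.pi * t) = s at *
  have hs : 3 / 4 ≤ s ^ 2 := by nlinarith
  have hf : 0 < (2 * s ^ 2 + s - 1) / 2 := by nlinarith
  have hu0 : Real.sin u = 0 := (mul_eq_zero.1 d2).resolve_left hf.ne'
  have hu := Real.sin_sq_add_cos_sq u
  have hc : (Real.cos u - 1) * (Real.cos u + 1) = 0 := by rw [hu0] at hu; linear_combination hu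
  rcases mul_eq_zero.1 hc with hc | hc
  · rw [sub_eq_zero.1 hc] at d1; nlinarith
  · rw [eq_neg_of_add_eq_zero_left hc] at d1; nlinarith

theorem sin_pi_mul_ne_one {t : ℝ} (h : t ∈ Set.Icc (-1 / 2 : ℝ) (1 / 3) ∪ Set.Icc (2 / 3) (3 / 2)) :
    Real.sin (Real.pi * t) ≠ 1 := by
  have hp := Real.pi_pos
  have aux : ∀ x ∈ Set.Icc (-1 / 2 : ℝ) (1 / 3), Real.sin (Real.pi * x) < 1 := fun x hx => by
    refine (Real.sin_lt_sin_of_lt_of_le_pi_div_two ?_ le_rfl ?_).trans_eq Real.sin_pi_div_two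
    · nlinarith [hx.1]
    · nlinarith [hx.2]
  rcases h with h | h
  · exact (aux t h).ne
  · have := aux (1 - t) ⟨by linarith [h.2], by linarith [h.1]⟩
    rw [mul_sub, mul_one, Real.sin_pi_sub] at this
    exact this.ne

theorem sqrt_three_div_two_le_sin {t : ℝ} (h : t ∈ Set.Icc (1 / 3 : ℝ) (2 / 3)) :
    √3 / 2 ≤ Real.sin (Real.pi * t) := by
  have hp := Real.pi_pos
  have aux : ∀ x ∈ Set.Icc (1 / 3 : ℝ) (1 / 2), √3 / 2 ≤ Real.sin (Real.pi * x) := fun x hx => by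
    rw [← Real.sin_pi_div_three]
    refine Real.sin_le_sin_of_le_of_le_pi_div_two ?_ ?_ ?_
    · linarith
    · nlinarith [hx.2]
    · nlinarith [hx.1]
  rcases le_total t (1 / 2) with h' | h'
  · exact aux t ⟨h.1, h'⟩
  · have := aux (1 - t) ⟨by linarith [h.2], by linarith⟩
    rwa [mul_sub, mul_one, Real.sin_pi_sub] at this

/-- The second term is positive if C < 0 or C > 1/2. For 0 ≤ C ≤ 1/2 it is at least -0.095, while S²
≥ 3/4 makes the first at least 0.255. -/
theorem quadratic_pos {n f g S C : ℝ} (hn1 : n ≤ 1) (hn : 0 < n)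
    (hu : S ^ 2 + C ^ 2 = 1) (hf : 0.68 < f) (hg : 0 < g) (hg' : g < 0.19) :
    0 < f * S ^ 2 / 2 + n * ((-g + f * C) * C) := by
  have hf0 : 0 < f := by linarith
  rcases lt_or_ge C 0 with hC | hC
  · have h1 : -g + f * C < 0 := by nlinarith
    have h2 : 0 < n * ((-g + f * C) * C) := mul_pos hn (mul_pos_of_neg_of_neg h1 hC)
    have h3 : 0 ≤ f * S ^ 2 / 2 := by positivity
    linarith
  rcases lt_or_ge (1 / 2) C with hC' | hC'
  · have h1 : 0 < -g + f * C := by nlinarith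
    have h2 : 0 < n * ((-g + f * C) * C) := mul_pos hn (mul_pos h1 (by linarith))
    have h3 : 0 ≤ f * S ^ 2 / 2 := by positivity
    linarith
  · have h1 : n * (g * C - f * C ^ 2) ≤ g * C := by
      have h2 : n * (g * C) ≤ 1 * (g * C) := mul_le_mul_of_nonneg_right hn1 (by positivity)
      have h3 : 0 ≤ n * (f * C ^ 2) := by positivity
      linarith
    have h2 : g * C ≤ 0.19 * (1 / 2) := mul_le_mul hg'.le hC' hC (by norm_num)
    have h3 : 3 / 4 ≤ S ^ 2 := by nlinarith
    have h4 : 0.68 * (3 / 4) ≤ f * S ^ 2 := mul_le_mul hf.le h3 (by norm_num) hf0.le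
    linarith

/-- Up to the factor 9 this is the real part that confines G · conj F to a half-plane turning with
u, with the sense of turning given by the sign σ of cos(πt). -/
theorem tangent_halfTurn_pos {t σ : ℝ} (u : ℝ) (hσ : σ ^ 2 = 1)
    (hc : Real.cos (Real.pi * t) = σ / 2) (hs : Real.sin (Real.pi * t) = √3 / 2) :
    0 < σ * ((halfTurn u).tangent t 0 * (halfTurn u).tangent t 2) * Real.sin u +
      (halfTurn u).tangent t 1 * Real.cos u := by
  have d0 := direction_eq_norm_smul_tangent u t 0
  have d1 := direction_eq_norm_smul_tangent u t 1
  have d2 := direction_eq_norm_smul_tangent u t 2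
  have hn := norm_sq_direction u (Real.cos (Real.pi * t)) (Real.sin (Real.pi * t))
  have hpos : 0 < ‖direction u (Real.cos (Real.pi * t)) (Real.sin (Real.pi * t))‖ :=
    norm_pos_iff.2 (direction_ne_zero u (Real.sin_sq_add_cos_sq _))
  generalize ‖direction u (Real.cos (Real.pi * t)) (Real.sin (Real.pi * t))‖ = n at *
  simp only [direction, PiLp.toLp_apply, Matrix.cons_val] at d0 d1 d2
  rw [hs] at d1 d2 hn
  rw [hc] at d0 hn
  generalize (halfTurn u).tangent t 0 = x at *
  generalize (halfTurn u).tangent t 1 = y at *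
  generalize (halfTurn u).tangent t 2 = z at *
  have hu := Real.sin_sq_add_cos_sq u
  generalize Real.sin u = S at *
  generalize Real.cos u = C at *
  have h3 : √3 ^ 2 = (3 : ℝ) := Real.sq_sqrt (by norm_num)
  have h3l : (1.73 : ℝ) < √3 := by nlinarith [Real.sqrt_nonneg 3]
  have h3u : √3 < (1.74 : ℝ) := by nlinarith [Real.sqrt_nonneg 3]
  -- At s = √3/2 the direction is (σ/2, -g + f cos u, f sin u), with f ≈ 0.683 and g ≈ 0.183.
  obtain ⟨f, hf⟩ : ∃ f, f = (1 / 2 + √3 / 2) / 2 := ⟨_, rfl⟩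
  obtain ⟨g, hg⟩ : ∃ g, g = (√3 / 2 - 1 / 2) / 2 := ⟨_, rfl⟩
  have ef : (2 * (√3 / 2) ^ 2 + √3 / 2 - 1) / 2 = f := by rw [hf]; linear_combination h3 / 4
  have eg : (2 * (√3 / 2) ^ 2 - √3 / 2 - 1) / 2 = -g := by rw [hg]; linear_combination h3 / 4
  rw [ef, eg] at d1 hn
  rw [ef] at d2
  have hfl : 0.68 < f := by linarith
  have hfu : f < 0.69 := by linarith
  have hgl : 0.18 < g := by linarith
  have hgu : g < 0.19 := by linarith
  have hfg : f * f + g * g = 1 / 2 := by rw [hf, hg]; linear_combination h3 / 8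
  have hfg' : f * g = 1 / 8 := by rw [hf, hg]; linear_combination h3 / 16
  have hC : -1 ≤ C ∧ C ≤ 1 := ⟨by nlinarith, by nlinarith⟩
  have hn1 : n ≤ 1 := by
    have : n ^ 2 = 3 / 4 - C / 4 := by
      rw [hn]; linear_combination hσ / 4 + f ^ 2 * hu + hfg - 2 * C * hfg'
    nlinarith
  have main := quadratic_pos hn1 hpos hu hfl (by linarith) hgu
  have e : n ^ 2 * (σ * (x * z) * S + y * C) = f * S ^ 2 / 2 + n * ((-g + f * C) * C) := by
    linear_combination -σ * S * n * z * d0 - σ * S * (σ / 2) * d2 - n * C * d1 + f * S ^ 2 / 2 * hσ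
  exact pos_of_mul_pos_right (e ▸ main) (by positivity)

theorem FramedLoop.re_pos_of_similar_halfTurn {p : FramedLoop} {u t : ℝ} {n : ℤ}
    (hp : ImmersedLoop.Similar p.base (halfTurn u)) (hn : (n : ℝ) ^ 2 = 1)
    (hc : Real.cos (Real.pi * t) = n / 2) (hs : Real.sin (Real.pi * t) = √3 / 2) :
    0 < (Complex.I * (p.secondInvariant t * conj (p.firstInvariant t)) *
      Complex.exp (n * u * Complex.I)).re := by
  have hpos := tangent_halfTurn_pos u hn hc hs
  have hcs : Real.cos (n * u) = Real.cos u ∧ Real.sin (n * u) = n * Real.sin u := by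
    have : ((n : ℝ) - 1) * (n + 1) = 0 := by linear_combination hn
    rcases mul_eq_zero.1 this with h | h
    · rw [sub_eq_zero.1 h]; simp
    · rw [eq_neg_of_add_eq_zero_left h]; simp
  rw [(p.invariants_of_similar_halfTurn hp t).2.2.2,
    show (n : ℂ) * u * Complex.I = ((n * u : ℝ) : ℂ) * Complex.I by push_cast; ring,
    Complex.exp_mul_I, ← Complex.ofReal_cos, ← Complex.ofReal_sin, hcs.1, hcs.2]
  generalize Real.sin u = S at *
  generalize Real.cos u = C at *
  simp
  linarith

/-- A section of the forget-framing map induces framings of the curves `halfTurn u`. -/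
theorem exists_framing_halfTurn {U : Set ModuliLoops} {s : U → ModuliFramedLoops}
    (hs : ∀ b : U, forgetFraming (s b) = b) {b : U} {u : ℝ}
    (hb : b.1 = (Quotient.mk _ (halfTurn u) : Quotient ImmersedLoop.similarSetoid)) :
    ∃ p : FramedLoop, ImmersedLoop.Similar p.base (halfTurn u) ∧
      s b = (Quotient.mk _ p : Quotient FramedLoop.similarSetoid) := by
  obtain ⟨p, hp⟩ := Quotient.exists_rep (s b : Quotient FramedLoop.similarSetoid)
  have h := (hs b).trans hb
  rw [← hp] at h
  exact ⟨p, Quotient.exact h, hp.symm⟩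

/-- A section of the forget-framing map over all loops turns the framing invariants into
continuous functions on the torus. -/
theorem exists_invariants_of_section {s : ↥(Set.univ : Set ModuliLoops) → ModuliFramedLoops}
    (hs : IsCurveFramingAlgorithm Set.univ s) :
    ∃ F G : ℝ → ℝ → ℂ, Continuous F.uncurry ∧ Continuous G.uncurry ∧
      (∀ t, Function.Periodic (F · t) (2 * Real.pi)) ∧
      (∀ t, Function.Periodic (G · t) (2 * Real.pi)) ∧
      ∀ u, ∃ p : FramedLoop, ImmersedLoop.Similar p.base (halfTurn u) ∧
        F u = p.firstInvariant ∧ G u = p.secondInvariant := by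
  obtain ⟨b, hb, hbq⟩ : ∃ b : ℝ → ↥(Set.univ : Set ModuliLoops), Continuous b ∧ ∀ u,
      (b u).1 = (Quotient.mk _ (halfTurn u) : Quotient ImmersedLoop.similarSetoid) :=
    ⟨fun u => ⟨(Quotient.mk _ (halfTurn u) : Quotient ImmersedLoop.similarSetoid), trivial⟩,
      (continuous_quotient_mk'.comp continuous_halfTurn).subtype_mk _, fun _ => rfl⟩
  obtain ⟨J, hJ, hJp⟩ := exists_continuous_descend FramedLoop.continuous_firstInvariant
    fun _ _ => FramedLoop.firstInvariant_eq_of_similar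
  obtain ⟨K, hK, hKp⟩ := exists_continuous_descend FramedLoop.continuous_secondInvariant
    fun _ _ => FramedLoop.secondInvariant_eq_of_similar
  have hm : Continuous fun x : ℝ × ℝ => (s (b x.1), x.2) :=
    ((hs.1.comp hb).comp continuous_fst).prodMk continuous_snd
  have hbp : ∀ u, b (u + 2 * Real.pi) = b u := fun u =>
    Subtype.ext (by rw [hbq, hbq, halfTurn_periodic u])
  refine ⟨fun u => J (s (b u)), fun u => K (s (b u)), hJ.comp hm, hK.comp hm,
    fun t u => by simp only [hbp], fun t u => by simp only [hbp], fun u => ?_⟩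
  obtain ⟨p, hp, hsp⟩ := exists_framing_halfTurn hs.2 (hbq u)
  exact ⟨p, hp, (congrArg J hsp).trans (hJp p), (congrArg K hsp).trans (hKp p)⟩

end FramedCurves

open FramedCurves in
theorem corollary4p5 :
    ¬ ∃ s : ↥(Set.univ : Set FramedCurves.ModuliLoops) → FramedCurves.ModuliFramedLoops,
      FramedCurves.IsCurveFramingAlgorithm Set.univ s := by
  rintro ⟨s, hs⟩
  obtain ⟨F, G, hF, hG, hFp, hGp, rep⟩ := exists_invariants_of_section hs
  have hF0 : ∀ u, ∀ t ∈ Set.Icc (1 / 3 : ℝ) (2 / 3), F u t ≠ 0 := fun u t ht => by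
    obtain ⟨p, hp, hpF, -⟩ := rep u
    rw [hpF]
    exact (p.invariants_of_similar_halfTurn hp t).1
      (tangent_halfTurn_zero_sq_ne_one (sqrt_three_div_two_le_sin ht))
  have hG0 : ∀ u, ∀ t ∈ Set.Icc (-1 / 2 : ℝ) (1 / 3) ∪ Set.Icc (2 / 3) (3 / 2), G u t ≠ 0 :=
    fun u t ht => by
      obtain ⟨p, hp, -, hpG⟩ := rep u
      rw [hpG]
      exact (p.invariants_of_similar_halfTurn hp t).2.1
        (tangent_halfTurn_two_sq_ne_one (sin_pi_mul_ne_one ht))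
  have hG3 : ∀ u, G u (3 / 2) = 3 := fun u => by
    obtain ⟨p, hp, -, hpG⟩ := rep u
    rw [hpG]
    exact (p.invariants_of_similar_halfTurn hp 0).2.2.1
  -- The times -1/2 and 3/2 are the same point of the circle, so t = 1/2 can be approached from both
  -- sides.
  have hG1 : ∀ u, G u (-1 / 2) = 3 := fun u => by
    obtain ⟨p, hp, -, hpG⟩ := rep u
    rw [← hG3 u, hpG, ← (p.invariant_periodic (-1 / 2)).2]
    norm_num
  have h3 : HasWinding (fun _ => (3 : ℂ)) 0 :=
    hasWinding_const (by simp)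
  obtain ⟨m, hm⟩ := exists_hasWinding hF (by norm_num) hFp hF0
  obtain ⟨k, hk⟩ := exists_hasWinding hG (by norm_num) hGp fun u t ht => hG0 u t (Or.inl ht)
  obtain ⟨l, hl⟩ := exists_hasWinding hG (by norm_num) hGp fun u t ht => hG0 u t (Or.inr ht)
  -- On each side of t = 1/2 the winding number of G is that of the constant 3.
  obtain rfl : k = 0 := (hk (-1 / 2) (by norm_num)).unique (by simpa only [hG1] using h3)
  obtain rfl : l = 0 := (hl (3 / 2) (by norm_num)).unique (by simpa only [hG3] using h3)
  have aux : ∀ (t : ℝ) (n : ℤ), (n : ℝ) ^ 2 = 1 → Real.cos (Real.pi * t) = n / 2 →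
      Real.sin (Real.pi * t) = √3 / 2 → HasWinding (F · t) m → HasWinding (G · t) 0 →
      m = n := fun t n hn hc hs h1 h2 => by
    have hFt : Continuous (F · t) := hF.uncurry_right t
    have hGt : Continuous (G · t) := hG.uncurry_right t
    have := (h2.mul h1.conj).eq_neg_of_re_pos (n := n) (by fun_prop)
      (fun u => by simp only [show F (u + 2 * Real.pi) t = F u t from hFp t u,
        show G (u + 2 * Real.pi) t = G u t from hGp t u]) fun u => by
        obtain ⟨p, hp, hpF, hpG⟩ := rep u
        rw [hpF, hpG]
        exact FramedLoop.re_pos_of_similar_halfTurn hp hn hc hs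
    omega
  -- The sign of cos(πt) changes between 1/3 and 2/3, giving m = 1 and m = -1.
  have e1 := aux (1 / 3) 1 (by norm_num)
    (by rw [mul_one_div, Real.cos_pi_div_three]; norm_num)
    (by rw [mul_one_div, Real.sin_pi_div_three]) (hm _ (by norm_num)) (hk _ (by norm_num))
  have e23 : Real.pi * (2 / 3) = Real.pi - Real.pi / 3 := by ring
  have e2 := aux (2 / 3) (-1) (by norm_num)
    (by rw [e23, Real.cos_pi_sub, Real.cos_pi_div_three]; norm_num)
    (by rw [e23, Real.sin_pi_sub, Real.sin_pi_div_three]) (hm _ (by norm_num))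
    (hl _ (by norm_num))
  omega
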